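/- **Notions.** Fix a Gödel numbering $\varphi$ of the partial computable functions, $W_i=\mathrm{dom}\,\varphi_i$, and a computable pairing $\langle\cdot,\cdot\rangle$, iterated to tuples. A *numbering* of a set $S$ is a partial map $\nu$ from $\mathbb N$ onto $S$. All topological spaces considered are $T_0$ and come with a partial numbering $B$ of a basis and a transitive relation $\prec$ on $\mathbb N$ such that $m\prec n$ implies $B_m\subseteq B_n$ (for $m,n\in\mathrm{dom}\,B$), and whenever $z\in B_m\cap B_n$ there is $a\in\mathrm{dom}\,B$ with $z\in B_a$, $a\prec m$, $a\prec n$. The Lacombe set $L_n=\bigcup_{a\in W_n}B_a$ is defined iff $W_n\subseteq \mathrm{dom}\,B$. Let $x$ be a numbering of such a space $(T,\tau)$. * $x$ is *computable* w.r.t. $\tau$ if there is a c.e. set $L$ such that $\langle i,n\rangle\in L\iff x_i\in B_n$ for all $i\in\mathrm{dom}\,x$, $n\in\mathrm{dom}\,B$. * $(T,\tau)$ is *effective* if $B$ is total and there is a partial computable $sb$ such that for $i\in\mathrm{dom}\,x$ with $x_i\in B_m\cap B_n$, $sb(i,m,n)$ is defined, $x_i\in B_{sb(i,m,n)}$ and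 $sb(i,m,n)\prec m,n$. * $m$ is an index of a normed computable enumeration *converging* to $y$ if $\varphi_m$ is total with values in $\mathrm{dom}\,B$, decreasing w.r.t. $\prec$, $y\in B_{\varphi_m(a)}$ for all $a$, and for each $n$ with $y\in B_n$ some $\varphi_m(a)\prec n$. * $x$ is *acceptable* if it is computable and there is a partial computable $pt$ with $x_{pt(m)}=y$ (in particular, defined) whenever $m$ is such an index for $y$. For a bi-topological space $\mathcal T=(T,\tau,\sigma)$ with numbering $x$: $\mathcal T$ is *bi-effective* if $(T,\tau)$ and $(T,\sigma)$ are effective; $x$ is *bi-computable* if it is computable w.r.t. both topologies; $x$ is *bi-acceptable* if it is bi-computable and there is a partial computable $pt$ with $x_{pt(\langle m,n\rangle)}=y$ whenever $m$, $n$ are indices of normed computable enumerations converging to the same $y$ w.r.t. $\tau$, $\sigma$, respectively; $\mathcal T$ is *computably bi-separable* if there is a c.e. $A\subseteq\mathrm{dom}\,x$ such that $\{x_i: i\in A\}$ is dense w.r.t. $\tau$ and w.r.t. $\sigma$. $\tau$ is *effectively regular w.r.t.* $\sigma$ if there are partial computable $s,t$ such that, if $x_i\in B^\tau_m$, then $s(i,m)$,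 $t(i,m)$, $B^\tau_{s(i,m)}$, $L^\sigma_{t(i,m)}$ are defined, $x_i\in B^\tau_{s(i,m)}\subseteq B^\tau_m$, $T\setminus B^\tau_m\subseteq L^\sigma_{t(i,m)}$ and $B^\tau_{s(i,m)}\cap L^\sigma_{t(i,m)}=\emptyset$; $\mathcal T$ is *effectively pairwise regular* if also $\sigma$ is effectively regular w.r.t. $\tau$. A map $F:T\to T'$ is an *effective operator* (w.r.t. $x,x'$) if there is a partial computable $f$ with $F(x_i)=x'_{f(i)}$ (in particular, defined) for all $i\in\mathrm{dom}\,x$. It is *effectively continuous* if there is a partial computable $g$ with $F^{-1}[B'_n]=L_{g(n)}$ (in particular, defined) for all $n\in\mathrm{dom}\,B'$, and *effectively bi-continuous* if it is so w.r.t. $\tau,\tau'$ and w.r.t. $\sigma,\sigma'$. A *quasi-metric* is $\delta:X\times X\to[0,\infty)$ with $\delta(x,x)=0$, the triangle inequality, and $x=y$ whenever $\delta(x,y)=\delta(y,x)=0$; $\delta^c(x,y)=\delta(y,x)$; $\tau_\delta$ has the balls $\{y:\delta(x,y)<r\}$ as a basis. Given $\beta:\mathbb N\to X$ with range dense w.r.t.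 $\max(\delta,\delta^c)$, put $B_{\langle i,m\rangle}=\{y:\delta(\beta_i,y)<2^{-m}\}$ and $\langle i,m\rangle\prec\langle j,n\rangle\iff\delta(\beta_j,\beta_i)+2^{-m}<2^{-n}$, and similarly for $\delta^c$. $(X,\delta)$ is *computable* if $\{\langle a,b,c,e\rangle:\delta(\beta_a,\beta_b)<c2^{-e}\}$ and $\{\langle a,b,c,e\rangle:\delta(\beta_a,\beta_b)>c2^{-e}\}$ are c.e. A point $y$ is *computable* if $D_y=\{\langle a,b,e\rangle:\delta(\beta_a,y)<2^{-e},\ \delta(y,\beta_b)<2^{-e}\}$ is c.e.; $X_c$ is the set of computable points, with numbering $x^c_i=y\iff W_i=D_y$, and with the topologies, basic open sets and relations $\prec$ restricted from $X$. **Proposition.** In the theorem "if $\mathcal T=(T,\tau,\sigma)$ is bi-effective and computably bi-separable with bi-acceptable numbering $x$, and $\mathcal T'=(T',\tau',\sigma')$ is effectively pairwise regular with bi-computable numbering $x'$, then every effective operator $F:T\to T'$ is effectively bi-continuous", the requirement that $x'$ be computable also with respect to $\sigma'$ cannot be dropped: the statement with "bi-computable" weakened to "computable with respect to $\tau'$"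 is false. More precisely, let $S=\{\bot,\top\}$, $\delta(y,z)=0$ if $y=z$ or $(y,z)=(\bot,\top)$, and $\delta(y,z)=1$ otherwise, with $\beta_0=\bot$ and $\beta_i=\top$ for $i>0$. Then $(S,\delta)$ is a computable quasi-metric space, all its points are computable, and $\tau_\delta=\{\emptyset,\{\top\},S\}$ is the Sierpinski topology. There are a computable metric space $(X,d)$, a numbering $x'$ of $S$, and a map $F:X_c\to S$ such that 1. $(X_c,\tau_d,\tau_{d^c})$ is bi-effective and computably bi-separable, and $x^c$ is bi-acceptable; 2. $(S,\tau_\delta,\tau_{\delta^c})$ with $x'$ is effectively pairwise regular, and $x'$ is acceptable with respect to $\tau_\delta$ but not computable with respect to $\tau_{\delta^c}$; 3. $F$ is an effective operator, but $F$ is not continuous with respect to $\tau_d$ and $\tau_\delta$, and hence not effectively bi-continuous. -/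

import Mathlib

open Set TopologicalSpace

namespace EffTop

/-! ### Computability on the natural numbers -/

/-- The standard Gödel numbering `φ` of the unary partial computable functions. -/
def phi (i : ℕ) : ℕ →. ℕ := (Denumerable.ofNat Nat.Partrec.Code i).eval

/-- The computably enumerable set `W i`, the domain of `φ i`. -/
def W (i : ℕ) : Set ℕ := {a | (phi i a).Dom}

theorem exists_W_eq {A : Set ℕ} (hA : REPred fun n => n ∈ A) : ∃ i, W i = A := by
  have h2 : Partrec fun n : ℕ => (Part.assert (n ∈ A) fun _ => Part.some ()).map fun _ => 0 :=
    Partrec.map hA ((Computable.const 0).to₂)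
  obtain ⟨c, hc⟩ := Nat.Partrec.Code.exists_code.1 (Partrec.nat_iff.1 h2)
  refine ⟨Encodable.encode c, ?_⟩
  ext n
  simp [W, phi, hc, Part.assert]

/-! ### Numberings -/

/-- A partial numbering of `S`: a partial map from the natural numbers onto `S`. -/
structure PNumbering (S : Type*) where
  toFun : ℕ →. S
  surj : ∀ y, ∃ i, y ∈ toFun i

/-! ### Spaces with a numbered strong basis -/

/-- A topological `T₀`-space together with a partial numbering `B` of a basis of its topology and a
strong inclusion `prec` with respect to which this basis is a strong basis. -/
structure IndexedSpace (T : Type*) where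
  top : TopologicalSpace T
  B : ℕ →. Set T
  isBasis : @IsTopologicalBasis T top {U | ∃ n, U ∈ B n}
  t0 : @T0Space T top
  prec : ℕ → ℕ → Prop
  prec_trans : ∀ {k m n}, prec k m → prec m n → prec k n
  /-- `prec` is a strong inclusion. -/
  prec_subset : ∀ {m n}, prec m n → ∀ U ∈ B m, ∀ V ∈ B n, U ⊆ V
  /-- The basis is a strong basis. -/
  strong : ∀ (z : T) (m n : ℕ), (∃ U ∈ B m, z ∈ U) → (∃ V ∈ B n, z ∈ V) →
    ∃ a, (∃ O ∈ B a, z ∈ O) ∧ prec a m ∧ prec a n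

namespace IndexedSpace

variable {T : Type*} (𝒯 : IndexedSpace T)

/-- `z ∈ Bₙ` (in particular `n` lies in the domain of `B`). -/
def Mem (z : T) (n : ℕ) : Prop := ∃ U ∈ 𝒯.B n, z ∈ U

/-- The numbering `L` of the Lacombe sets: `Lₙ` is the union of all `Bₐ` with `a ∈ Wₙ`, and it is
defined exactly if `Wₙ` is contained in the domain of `B`. -/
def lacombe (n : ℕ) : Part (Set T) :=
  ⟨∀ a ∈ W n, (𝒯.B a).Dom, fun _ => {y | ∃ a ∈ W n, 𝒯.Mem y a}⟩

/-- The subspace on `Z`, with basic open sets `Bₙ ∩ Z` and the same strong inclusion. -/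
def restrict (Z : Set T) : IndexedSpace Z where
  top := @instTopologicalSpaceSubtype T (· ∈ Z) 𝒯.top
  B n := (𝒯.B n).map fun U => Subtype.val ⁻¹' U
  isBasis := by
    let := 𝒯.top
    have h := 𝒯.isBasis.induced (Subtype.val : Z → T)
    have e : {U : Set Z | ∃ n, U ∈ (𝒯.B n).map fun U => (Subtype.val ⁻¹' U : Set Z)} =
        preimage (Subtype.val : Z → T) '' {U | ∃ n, U ∈ 𝒯.B n} := by
      ext U
      refine ⟨?_, ?_⟩
      · rintro ⟨n, hn⟩
        obtain ⟨V, hV, rfl⟩ := (Part.mem_map_iff _).1 hn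
        exact ⟨V, ⟨n, hV⟩, rfl⟩
      · rintro ⟨V, ⟨n, hV⟩, rfl⟩
        exact ⟨n, Part.mem_map _ hV⟩
    rw [e]
    exact h
  t0 := by
    let := 𝒯.top
    have := 𝒯.t0
    infer_instance
  prec := 𝒯.prec
  prec_trans := 𝒯.prec_trans
  prec_subset := by
    rintro m n h _ hU' _ hV'
    obtain ⟨U, hU, rfl⟩ := (Part.mem_map_iff _).1 hU'
    obtain ⟨V, hV, rfl⟩ := (Part.mem_map_iff _).1 hV'
    exact preimage_mono (𝒯.prec_subset h U hU V hV)
  strong := by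
    rintro z m n ⟨_, hU', hzU⟩ ⟨_, hV', hzV⟩
    obtain ⟨U, hU, rfl⟩ := (Part.mem_map_iff _).1 hU'
    obtain ⟨V, hV, rfl⟩ := (Part.mem_map_iff _).1 hV'
    obtain ⟨a, ⟨O, hO, hzO⟩, ham, han⟩ := 𝒯.strong z m n ⟨U, hU, hzU⟩ ⟨V, hV, hzV⟩
    exact ⟨a, ⟨_, Part.mem_map _ hO, hzO⟩, ham, han⟩

/-- The numbering `x` is computable with respect to the topology: the relation `xᵢ ∈ Bₙ` is the
restriction of a computably enumerable set to the domains of `x` and `B`. -/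
def IsComputable (x : PNumbering T) : Prop :=
  ∃ L : ℕ × ℕ → Prop, REPred L ∧
    ∀ i, ∀ y ∈ x.toFun i, ∀ n, (𝒯.B n).Dom → (L (i, n) ↔ 𝒯.Mem y n)

/-- The space is effective: `B` is total and the strong basis property holds effectively. -/
def IsEffective (x : PNumbering T) : Prop :=
  (∀ n, (𝒯.B n).Dom) ∧
  ∃ sb : ℕ × ℕ × ℕ →. ℕ, Partrec sb ∧
    ∀ i, ∀ y ∈ x.toFun i, ∀ m n, 𝒯.Mem y m → 𝒯.Mem y n →
      ∃ a ∈ sb (i, m, n), 𝒯.Mem y a ∧ 𝒯.prec a m ∧ 𝒯.prec a n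

/-- `m` is an index of a normed computable enumeration of basic open sets that converges to `y`:
`φ m` is a total function `f` with values in the domain of `B`, it is decreasing with respect to
`prec`, and the sets `B (f a)` form a strong basis of the neighbourhood filter of `y`. -/
def ConvergesTo (m : ℕ) (y : T) : Prop :=
  ∃ f : ℕ → ℕ, (∀ a, f a ∈ phi m a) ∧
    (∀ a b, a < b → 𝒯.prec (f b) (f a)) ∧
    (∀ a, 𝒯.Mem y (f a)) ∧
    ∀ n, 𝒯.Mem y n → ∃ a, 𝒯.prec (f a) n

/-- The numbering `x` allows effective limit passing. -/
def AllowsLimitPassing (x : PNumbering T) : Prop :=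
  ∃ pt : ℕ →. ℕ, Partrec pt ∧ ∀ m y, 𝒯.ConvergesTo m y → ∃ i ∈ pt m, y ∈ x.toFun i

/-- The numbering `x` is acceptable. -/
def IsAcceptable (x : PNumbering T) : Prop :=
  𝒯.AllowsLimitPassing x ∧ 𝒯.IsComputable x

end IndexedSpace

/-! ### Bi-topological spaces -/

/-- A bi-topological space `(T, τ, σ)`, both topologies being `T₀` and given with a numbered strong
basis. -/
structure BiSpace (T : Type*) where
  τ : IndexedSpace T
  σ : IndexedSpace T

/-- `τ` is effectively regular with respect to `σ`. -/
def EffectivelyRegular {T : Type*} (τ σ : IndexedSpace T) (x : PNumbering T) : Prop :=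
  ∃ s t : ℕ × ℕ →. ℕ, Partrec s ∧ Partrec t ∧
    ∀ i, ∀ y ∈ x.toFun i, ∀ m, ∀ U ∈ τ.B m, y ∈ U →
      ∃ a ∈ s (i, m), ∃ V ∈ τ.B a, ∃ b ∈ t (i, m), ∃ O ∈ σ.lacombe b,
        y ∈ V ∧ V ⊆ U ∧ Uᶜ ⊆ O ∧ V ∩ O = ∅

namespace BiSpace

variable {T : Type*} (𝒯 : BiSpace T)

/-- The bi-topological subspace on `Z`. -/
def restrict (Z : Set T) : BiSpace Z := ⟨𝒯.τ.restrict Z, 𝒯.σ.restrict Z⟩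

def IsBiComputable (x : PNumbering T) : Prop :=
  𝒯.τ.IsComputable x ∧ 𝒯.σ.IsComputable x

/-- The numbering `x` allows effective bi-limit passing. -/
def AllowsBiLimitPassing (x : PNumbering T) : Prop :=
  ∃ pt : ℕ →. ℕ, Partrec pt ∧ ∀ m n y, 𝒯.τ.ConvergesTo m y → 𝒯.σ.ConvergesTo n y →
    ∃ i ∈ pt (Nat.pair m n), y ∈ x.toFun i

def IsBiAcceptable (x : PNumbering T) : Prop :=
  𝒯.AllowsBiLimitPassing x ∧ 𝒯.IsBiComputable x

def IsBiEffective (x : PNumbering T) : Prop :=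
  𝒯.τ.IsEffective x ∧ 𝒯.σ.IsEffective x

/-- Effective pairwise regularity. -/
def IsEffectivelyPairwiseRegular (x : PNumbering T) : Prop :=
  EffectivelyRegular 𝒯.τ 𝒯.σ x ∧ EffectivelyRegular 𝒯.σ 𝒯.τ x

/-- There is an enumerable subset of `T` that is dense with respect to both topologies. -/
def IsComputablyBiSeparable (x : PNumbering T) : Prop :=
  ∃ A : ℕ → Prop, REPred A ∧ (∀ i, A i → (x.toFun i).Dom) ∧
    @Dense T 𝒯.τ.top {y | ∃ i, A i ∧ y ∈ x.toFun i} ∧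
    @Dense T 𝒯.σ.top {y | ∃ i, A i ∧ y ∈ x.toFun i}

end BiSpace

/-! ### Operators -/

/-- `F` is an effective operator with respect to the numberings `x` and `x'`. -/
def IsEffectiveOperator {T T' : Type*} (x : PNumbering T) (x' : PNumbering T') (F : T → T') : Prop :=
  ∃ f : ℕ →. ℕ, Partrec f ∧ ∀ i, ∀ y ∈ x.toFun i, ∃ j ∈ f i, F y ∈ x'.toFun j

/-- `F` is effectively continuous. -/
def EffectivelyContinuous {T T' : Type*} (τ : IndexedSpace T) (τ' : IndexedSpace T')
    (F : T → T') : Prop :=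
  ∃ g : ℕ →. ℕ, Partrec g ∧ ∀ n, ∀ V ∈ τ'.B n, ∃ a ∈ g n, F ⁻¹' V ∈ τ.lacombe a

/-- `F` is effectively bi-continuous. -/
def EffectivelyBiContinuous {T T' : Type*} (𝒯 : BiSpace T) (𝒯' : BiSpace T')
    (F : T → T') : Prop :=
  EffectivelyContinuous 𝒯.τ 𝒯'.τ F ∧ EffectivelyContinuous 𝒯.σ 𝒯'.σ F

/-! ### Quasi-metric spaces -/

/-- A quasi-metric on `X`. -/
structure QuasiMetric (X : Type*) where
  δ : X → X → ℝ
  nonneg : ∀ x y, 0 ≤ δ x y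
  self : ∀ x, δ x x = 0
  triangle : ∀ x y z, δ x z ≤ δ x y + δ y z
  eq_of : ∀ x y, δ x y = 0 → δ y x = 0 → x = y

namespace QuasiMetric

variable {X : Type*} (q : QuasiMetric X)

def ball (x : X) (r : ℝ) : Set X := {y | q.δ x y < r}

/-- The quasi-metric topology, with the balls as a basis. -/
@[reducible] def topology : TopologicalSpace X where
  IsOpen U := ∀ x ∈ U, ∃ r > 0, q.ball x r ⊆ U
  isOpen_univ _ _ := ⟨1, one_pos, subset_univ _⟩
  isOpen_inter U V hU hV x hx := by
    obtain ⟨r, hr, h1⟩ := hU x hx.1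
    obtain ⟨s, hs, h2⟩ := hV x hx.2
    exact ⟨min r s, lt_min hr hs, fun y hy =>
      ⟨h1 (lt_of_lt_of_le (b := min r s) hy (min_le_left _ _)),
        h2 (lt_of_lt_of_le (b := min r s) hy (min_le_right _ _))⟩⟩
  isOpen_sUnion 𝒰 h𝒰 := by
    rintro x ⟨U, hU, hx⟩
    obtain ⟨r, hr, h⟩ := h𝒰 U hU x hx
    exact ⟨r, hr, h.trans (subset_sUnion_of_mem hU)⟩

theorem isOpen_ball (x : X) (r : ℝ) : @IsOpen X q.topology (q.ball x r) := by
  intro y hy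
  refine ⟨r - q.δ x y, sub_pos.2 hy, fun z hz => ?_⟩
  have h1 := q.triangle x y z
  have h2 : q.δ y z < r - q.δ x y := hz
  change q.δ x z < r
  linarith

/-- The conjugate quasi-metric. -/
def conj : QuasiMetric X where
  δ x y := q.δ y x
  nonneg x y := q.nonneg y x
  self := q.self
  triangle x y z := by
    have := q.triangle z y x
    linarith
  eq_of x y h1 h2 := q.eq_of x y h2 h1

/-- The symmetrisation of a quasi-metric. -/
def symm : QuasiMetric X where
  δ x y := max (q.δ x y) (q.δ y x)
  nonneg x y := le_max_of_le_left (q.nonneg x y)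
  self x := by simp [q.self]
  triangle x y z := by
    have h1 := q.triangle x y z
    have h2 := q.triangle z y x
    apply max_le
    · linarith [le_max_left (q.δ x y) (q.δ y x), le_max_left (q.δ y z) (q.δ z y)]
    · linarith [le_max_right (q.δ x y) (q.δ y x), le_max_right (q.δ y z) (q.δ z y)]
  eq_of x y h _ := by
    have h1 := le_max_left (q.δ x y) (q.δ y x)
    have h2 := le_max_right (q.δ x y) (q.δ y x)
    exact q.eq_of x y (le_antisymm (h ▸ h1) (q.nonneg _ _)) (le_antisymm (h ▸ h2) (q.nonneg _ _))

end QuasiMetric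

/-- A quasi-metric space with a total numbering `β` of a subset that is dense with respect to the
topology of the symmetrisation. -/
structure SepQuasiMetric (X : Type*) extends QuasiMetric X where
  β : ℕ → X
  dense : @DenseRange X toQuasiMetric.symm.topology ℕ β

namespace SepQuasiMetric

variable {X : Type*} (q : SepQuasiMetric X)

theorem exists_near (x : X) {ε : ℝ} (hε : 0 < ε) :
    ∃ a, q.δ x (q.β a) < ε ∧ q.δ (q.β a) x < ε := by
  let := q.toQuasiMetric.symm.topology
  have hx : x ∈ q.toQuasiMetric.symm.ball x ε := by
    change q.toQuasiMetric.symm.δ x x < ε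
    rw [q.toQuasiMetric.symm.self]
    exact hε
  obtain ⟨a, ha⟩ := q.dense.exists_mem_open (q.toQuasiMetric.symm.isOpen_ball x ε) ⟨x, hx⟩
  exact ⟨a, max_lt_iff.1 ha⟩

/-- The conjugate quasi-metric, with the same dense sequence. -/
def conj : SepQuasiMetric X where
  toQuasiMetric := q.toQuasiMetric.conj
  β := q.β
  dense := by
    have h : q.toQuasiMetric.conj.symm = q.toQuasiMetric.symm := by
      simp only [QuasiMetric.symm, QuasiMetric.conj, QuasiMetric.mk.injEq]
      funext x y
      exact max_comm _ _
    rw [h]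
    exact q.dense

theorem exists_refine (z : X) {j n j' n' : ℕ} (h : q.δ (q.β j) z < (1 / 2 : ℝ) ^ n)
    (h' : q.δ (q.β j') z < (1 / 2 : ℝ) ^ n') :
    ∃ i m : ℕ, q.δ (q.β i) z < (1 / 2 : ℝ) ^ m ∧
      q.δ (q.β j) (q.β i) + (1 / 2 : ℝ) ^ m < (1 / 2 : ℝ) ^ n ∧
      q.δ (q.β j') (q.β i) + (1 / 2 : ℝ) ^ m < (1 / 2 : ℝ) ^ n' := by
  obtain ⟨ε, hε, h1, h2⟩ : ∃ ε > 0, ε ≤ (1 / 2 : ℝ) ^ n - q.δ (q.β j) z ∧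
      ε ≤ (1 / 2 : ℝ) ^ n' - q.δ (q.β j') z :=
    ⟨_, lt_min (sub_pos.2 h) (sub_pos.2 h'), min_le_left _ _, min_le_right _ _⟩
  obtain ⟨m, hm⟩ := exists_pow_lt_of_lt_one (half_pos hε) (by norm_num : (1 / 2 : ℝ) < 1)
  obtain ⟨i, hi1, hi2⟩ := q.exists_near z (by positivity : (0 : ℝ) < (1 / 2 : ℝ) ^ m)
  refine ⟨i, m, hi2, ?_, ?_⟩
  · linarith [q.triangle (q.β j) z (q.β i)]
  · linarith [q.triangle (q.β j') z (q.β i)]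

/-- The quasi-metric topology with basic open sets `B ⟨i, m⟩`, the balls of radius `2⁻ᵐ` about
`β i`, and the strong inclusion `⟨i, m⟩ ≺ ⟨j, n⟩ ↔ δ (β j) (β i) + 2⁻ᵐ < 2⁻ⁿ`. -/
def space : IndexedSpace X where
  top := q.topology
  B n := Part.some (q.ball (q.β n.unpair.1) ((1 / 2) ^ n.unpair.2))
  isBasis := by
    let := q.topology
    refine isTopologicalBasis_of_isOpen_of_nhds ?_ ?_
    · rintro U ⟨n, hn⟩
      rw [Part.mem_some_iff.1 hn]
      exact q.isOpen_ball _ _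
    · intro z U hz hU
      obtain ⟨r, hr, hrU⟩ := hU z hz
      obtain ⟨m, hm⟩ := exists_pow_lt_of_lt_one (half_pos hr) (by norm_num : (1 / 2 : ℝ) < 1)
      obtain ⟨i, hi1, hi2⟩ := q.exists_near z (by positivity : (0 : ℝ) < (1 / 2 : ℝ) ^ m)
      refine ⟨_, ⟨Nat.pair i m, Part.mem_some _⟩, ?_, fun y hy => hrU ?_⟩
      · simpa [QuasiMetric.ball] using hi2
      · have hy' : q.δ (q.β i) y < (1 / 2 : ℝ) ^ m := by simpa [QuasiMetric.ball] using hy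
        change q.δ z y < r
        linarith [q.triangle z (q.β i) y]
  t0 := by
    let := q.topology
    refine ⟨fun x y hxy => ?_⟩
    have key : ∀ x y : X, Inseparable x y → q.δ x y = 0 := by
      intro x y h
      refine le_antisymm (le_of_forall_pos_lt_add fun ε hε => ?_) (q.nonneg x y)
      have hx : x ∈ q.ball x ε := by
        change q.δ x x < ε
        rw [q.self]
        exact hε
      rw [zero_add]
      exact (h.mem_open_iff (q.isOpen_ball x ε)).1 hx
    exact q.eq_of x y (key x y hxy) (key y x hxy.symm)
  prec k l := q.δ (q.β l.unpair.1) (q.β k.unpair.1) + (1 / 2) ^ k.unpair.2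
    < (1 / 2 : ℝ) ^ l.unpair.2
  prec_trans := by
    intro k m n h1 h2
    linarith [q.triangle (q.β n.unpair.1) (q.β m.unpair.1) (q.β k.unpair.1)]
  prec_subset := by
    intro m n h U hU V hV y hy
    rw [Part.mem_some_iff.1 hU] at hy
    rw [Part.mem_some_iff.1 hV]
    have hy' : q.δ (q.β m.unpair.1) y < (1 / 2 : ℝ) ^ m.unpair.2 := hy
    change q.δ (q.β n.unpair.1) y < (1 / 2 : ℝ) ^ n.unpair.2
    linarith [q.triangle (q.β n.unpair.1) (q.β m.unpair.1) y]
  strong := by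
    rintro z m n ⟨U, hU, hzU⟩ ⟨V, hV, hzV⟩
    rw [Part.mem_some_iff.1 hU] at hzU
    rw [Part.mem_some_iff.1 hV] at hzV
    obtain ⟨i, k, h1, h2, h3⟩ := q.exists_refine z hzU hzV
    refine ⟨Nat.pair i k, ⟨_, Part.mem_some _, ?_⟩, ?_, ?_⟩
    · simpa [QuasiMetric.ball] using h1
    · simpa using h2
    · simpa using h3

/-- The bi-topological space given by the topologies of `δ` and of its conjugate. -/
def biSpace : BiSpace X := ⟨q.space, q.conj.space⟩

/-- The quasi-metric space is computable. -/
def IsComputable : Prop :=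
  (REPred fun p : ℕ × ℕ × ℕ × ℕ =>
    q.δ (q.β p.1) (q.β p.2.1) < (p.2.2.1 : ℝ) * (1 / 2) ^ p.2.2.2) ∧
  (REPred fun p : ℕ × ℕ × ℕ × ℕ =>
    q.δ (q.β p.1) (q.β p.2.1) > (p.2.2.1 : ℝ) * (1 / 2) ^ p.2.2.2)

/-- The set of all `⟨⟨a, b⟩, e⟩` with `δ (β a) y < 2⁻ᵉ` and `δ y (β b) < 2⁻ᵉ`. -/
def approx (y : X) : Set ℕ :=
  {n | q.δ (q.β n.unpair.1.unpair.1) y < (1 / 2) ^ n.unpair.2 ∧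
    q.δ y (q.β n.unpair.1.unpair.2) < (1 / 2) ^ n.unpair.2}

theorem approx_injective : Function.Injective q.approx := by
  have key : ∀ y z : X, q.approx y = q.approx z → q.δ y z = 0 := by
    intro y z h
    refine le_antisymm (le_of_forall_pos_lt_add fun ε hε => ?_) (q.nonneg y z)
    obtain ⟨e, he⟩ := exists_pow_lt_of_lt_one (half_pos hε) (by norm_num : (1 / 2 : ℝ) < 1)
    obtain ⟨a, h1, h2⟩ := q.exists_near y (by positivity : (0 : ℝ) < (1 / 2 : ℝ) ^ e)
    have hm : Nat.pair (Nat.pair a a) e ∈ q.approx y := by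
      simpa only [approx, mem_ofPred_eq, Nat.unpair_pair] using ⟨h2, h1⟩
    rw [h] at hm
    have h3 : q.δ (q.β a) z < (1 / 2 : ℝ) ^ e := by
      have := hm.1
      simpa using this
    linarith [q.triangle y (q.β a) z]
  exact fun y z h => q.eq_of y z (key y z h) (key z y h.symm)

/-- The set `X_c` of the computable points. -/
def computablePoints : Set X := {y | REPred fun n => n ∈ q.approx y}

open Classical in
/-- The numbering `x^c` of the computable points: `x^c i = y` if `W i = approx y`. -/
noncomputable def xc : PNumbering q.computablePoints where
  toFun i := ⟨∃ y : q.computablePoints, W i = q.approx y, fun h => h.choose⟩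
  surj y := by
    obtain ⟨i, hi⟩ := exists_W_eq y.2
    have h : ∃ y : q.computablePoints, W i = q.approx y := ⟨y, hi⟩
    exact ⟨i, h, Subtype.ext (q.approx_injective (h.choose_spec.symm.trans hi))⟩

/-- The bi-topological space `(X_c, τ_δ, τ_{δ^c})`. -/
def computableBiSpace : BiSpace q.computablePoints := q.biSpace.restrict q.computablePoints

end SepQuasiMetric

open Classical in
/-- The quasi-metric on the two-point set `{⊥, ⊤}`, here `Prop`, with dense sequence
`⊥, ⊤, ⊤, …`. -/
noncomputable def sierpinski : SepQuasiMetric Prop where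
  δ y z := if y = z ∨ (y = ⊥ ∧ z = ⊤) then 0 else 1
  nonneg y z := by split_ifs <;> norm_num
  self y := by simp
  triangle x y z := by
    by_cases hx : x <;> by_cases hy : y <;> by_cases hz : z <;> simp [hx, hy, hz]
  eq_of x y := by
    by_cases hx : x <;> by_cases hy : y <;> simp [hx, hy]
  β i := if i = 0 then ⊥ else ⊤
  dense := by
    have h : Function.Surjective fun i : ℕ => if i = 0 then (⊥ : Prop) else ⊤ := by
      intro p
      by_cases hp : p
      · exact ⟨1, by simp [hp]⟩
      · exact ⟨0, by simp [hp]⟩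
    exact @Function.Surjective.denseRange _ (QuasiMetric.topology _) _ _ h

end EffTop

open EffTop

namespace EffTop

/-! ### Computably enumerable predicates -/

/-! Name truth values by the halting problem: `i` names the proposition `0 ∈ W i` (`haltNumbering`).
Being `⊤` is then semidecidable from a name, so the numbering is computable and even acceptable for
the Sierpinski topology. In the conjugate topology `{⊥}` is open, and computability there would make
the complement of the halting problem enumerable. Every enumerable property of indices can be named
computably (`exists_halt_index`), so an effective operator into this numbered space can be built
from any property of points that is semidecidable from their indices. It remains to find such a
property on a computable metric space that is not open.

The space is `sequenceSpace`: a limit point `0` and, for each level `l`, infinitely many isolated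
points at distance `2⁻ˡ` from `0`. A partial computable `g` recovers a nonzero point from any of its
indices (`exists_point_of_index`). Call `y` small if `y = 0` or `g j = y` for some `j < level y`.
Given an index `i` of `y`, wait until `y` is seen within `2⁻ⁱ` of `0`, or until `y` is identified by
`g` and a small `j` is found. In the first case `y = 0` or `i < level y`, so `i` itself witnesses
smallness; hence the test is sound and complete (`smallIndex_isEffectiveOperator`). But at level `n`
only `n` values of `j` are available and each produces at most one point, so infinitely many points
of that level are not small, and the property fails in every neighbourhood of `0`
(`smallIndex_not_isOpen`).

The hypotheses on the domain hold for general reasons: the metric is symmetric, so both topologies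
agree, and an index of a point enumerates the basic balls containing it. -/

theorem re_comp {α β : Type*} [Primcodable α] [Primcodable β] {p : β → Prop} {f : α → β}
    (hp : REPred p) (hf : Computable f) : REPred fun a => p (f a) :=
  Partrec.comp hp hf

theorem primrecPred_re {α : Type*} [Primcodable α] {p : α → Prop} (hp : PrimrecPred p) :
    REPred p := by
  obtain ⟨_, h⟩ := hp
  exact (ComputablePred.to_re ⟨inferInstance, h.to_comp⟩)

/-- Step-bounded evaluation of a code for `p` turns enumerability into a decidable search over
stages `k`. -/
theorem re_exists_stage {α : Type*} [Primcodable α] {p : α → Prop} (hp : REPred p) :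
    ∃ h : α → ℕ → Bool, Computable₂ h ∧ ∀ a, p a ↔ ∃ k, h a k = true := by
  obtain ⟨c, hc⟩ := Nat.Partrec.Code.exists_code.1 hp
  refine ⟨fun a k => (c.evaln k (Encodable.encode a)).isSome, ?_, fun a => ?_⟩
  · refine (Primrec.option_isSome.comp ?_).to_comp
    exact Nat.Partrec.Code.primrec_evaln.comp (Primrec.pair
      (Primrec.pair Primrec.snd (Primrec.const c)) (Primrec.encode.comp Primrec.fst))
  · have h1 : p a ↔ (c.eval (Encodable.encode a)).Dom := by
      simp [hc, Part.assert]
    rw [h1, Part.dom_iff_mem]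
    simp only [Nat.Partrec.Code.evaln_complete, Option.isSome_iff_exists]
    exact exists_comm

theorem re_of_stage {α : Type*} [Primcodable α] {h : α → ℕ → Bool} (hh : Computable₂ h) :
    REPred fun a => ∃ k, h a k = true := by
  have h1 : Partrec fun a => Nat.rfindOpt fun k => bif h a k then some () else none :=
    Partrec.rfindOpt (Computable.cond hh (Computable.const _) (Computable.const _)).to₂
  refine h1.dom_re.of_eq fun a => ?_
  rw [Nat.rfindOpt_dom]
  refine exists_congr fun k => ?_
  cases h a k <;> simp

/-- Selection: a computably enumerable relation has a partial computable choice function. -/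
theorem re_select {α : Type*} [Primcodable α] {R : α → ℕ → Prop}
    (hR : REPred fun p : α × ℕ => R p.1 p.2) :
    ∃ s : α →. ℕ, Partrec s ∧ (∀ a, ∀ y ∈ s a, R a y) ∧ ∀ a, (s a).Dom ↔ ∃ y, R a y := by
  obtain ⟨h, hh, hp⟩ := re_exists_stage hR
  have hu : Computable fun p : α × ℕ => p.2.unpair.1 :=
    (Primrec.fst.comp (Primrec.unpair.comp Primrec.snd)).to_comp
  have hv : Computable fun p : α × ℕ => p.2.unpair.2 :=
    (Primrec.snd.comp (Primrec.unpair.comp Primrec.snd)).to_comp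
  -- Dovetailing: `t` codes a candidate value together with a stage at which it is checked.
  refine ⟨fun a => Nat.rfindOpt fun t =>
    bif h (a, t.unpair.1) t.unpair.2 then some t.unpair.1 else none, ?_, ?_, ?_⟩
  · exact Partrec.rfindOpt (Computable.cond (hh.comp (Computable.fst.pair hu) hv)
      (Computable.option_some.comp hu) (Computable.const _)).to₂
  · intro a y hy
    obtain ⟨t, ht⟩ := Nat.rfindOpt_spec hy
    refine (hp (a, y)).2 ⟨t.unpair.2, ?_⟩
    cases e : h (a, t.unpair.1) t.unpair.2
    · simp [e] at ht
    · simp only [e, cond_true, Option.mem_def, Option.some.injEq] at ht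
      rw [← ht, e]
  · intro a
    rw [Nat.rfindOpt_dom]
    constructor
    · rintro ⟨t, y, hy⟩
      refine ⟨t.unpair.1, (hp (a, _)).2 ⟨t.unpair.2, ?_⟩⟩
      by_contra e
      simp [Bool.not_eq_true _ ▸ e] at hy
    · rintro ⟨y, hy⟩
      obtain ⟨k, hk⟩ := (hp (a, y)).1 hy
      exact ⟨Nat.pair y k, y, by simp [hk]⟩

theorem re_exists {α : Type*} [Primcodable α] {R : α → ℕ → Prop}
    (hR : REPred fun p : α × ℕ => R p.1 p.2) : REPred fun a => ∃ y, R a y := by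
  obtain ⟨s, hs, -, h⟩ := re_select hR
  exact hs.dom_re.of_eq h

theorem re_and {α : Type*} [Primcodable α] {p q : α → Prop} (hp : REPred p) (hq : REPred q) :
    REPred fun a => p a ∧ q a := by
  have h : Partrec fun a => (Part.assert (p a) fun _ => Part.some ()).bind
      fun _ => Part.assert (q a) fun _ => Part.some () :=
    Partrec.bind hp (Partrec.comp hq Computable.fst).to₂
  refine h.dom_re.of_eq fun a => ?_
  simp [Part.assert]

/-- Evaluating the disjuncts one after the other could diverge on the first, so both are run in
parallel stage by stage. -/
theorem re_or {α : Type*} [Primcodable α] {p q : α → Prop} (hp : REPred p) (hq : REPred q) :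
    REPred fun a => p a ∨ q a := by
  obtain ⟨f, hf, h1⟩ := re_exists_stage hp
  obtain ⟨g, hg, h2⟩ := re_exists_stage hq
  refine (re_of_stage (h := fun a k => f a k || g a k)
    (Primrec.or.to_comp.comp hf hg)).of_eq fun a => ?_
  rw [h1, h2, ← exists_or]
  simp only [Bool.or_eq_true]

/-! ### Uniformity in Gödel numbers -/

theorem partrec_phi : Partrec₂ phi :=
  (Nat.Partrec.Code.eval_part.comp ((Computable.ofNat _).comp Computable.fst)
    Computable.snd).to₂

theorem re_mem_W : REPred fun p : ℕ × ℕ => p.2 ∈ W p.1 :=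
  Partrec.dom_re partrec_phi

theorem re_mem_graph {α : Type*} [Primcodable α] {f : α →. ℕ} (hf : Partrec f) :
    REPred fun p : α × ℕ => p.2 ∈ f p.1 := by
  have h : Partrec fun p : α × ℕ => (f p.1).bind fun v =>
      Part.assert (v = p.2) fun _ => Part.some () :=
    Partrec.bind (hf.comp Computable.fst) (re_comp (primrecPred_re (Primrec.eq (α := ℕ)))
      (Computable.snd.pair (Computable.snd.comp Computable.fst))).to₂
  refine h.dom_re.of_eq fun p => ?_
  simp [Part.dom_iff_mem, Part.mem_assert_iff]

theorem re_mem_phi : REPred fun p : (ℕ × ℕ) × ℕ => p.2 ∈ phi p.1.1 p.1.2 :=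
  re_mem_graph partrec_phi

/-- The `s`-`m`-`n` theorem: a computably enumerable family of sets has a computable sequence of
indices. -/
theorem exists_index {R : ℕ → ℕ → Prop} (hR : REPred fun p : ℕ × ℕ => R p.1 p.2) :
    ∃ f : ℕ → ℕ, Computable f ∧ ∀ a, W (f a) = {n | R a n} := by
  obtain ⟨i, hi⟩ := exists_W_eq (A := {t : ℕ | R t.unpair.1 t.unpair.2})
    (re_comp (f := Nat.unpair) hR Primrec.unpair.to_comp)
  refine ⟨fun a => Encodable.encode ((Denumerable.ofNat Nat.Partrec.Code i).curry a), ?_, ?_⟩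
  · exact (Primrec.encode.comp
      (Nat.Partrec.Code.primrec₂_curry.comp (Primrec.const _) Primrec.id)).to_comp
  · intro a
    ext n
    have := Set.ext_iff.1 hi (Nat.pair a n)
    simpa [W, phi] using this

/-! ### Sierpinski space -/

theorem sierpinski_delta_lt {y z : Prop} {r : ℝ} (hr : 0 < r) (hr1 : r ≤ 1) :
    sierpinski.δ y z < r ↔ (y → z) := by
  by_cases hy : y <;> by_cases hz : z <;> simp [sierpinski, hy, hz, hr, hr1]

theorem half_pow_pos (n : ℕ) : 0 < (1 / 2 : ℝ) ^ n := by positivity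

theorem half_pow_le (n : ℕ) : (1 / 2 : ℝ) ^ n ≤ 1 := pow_le_one₀ (by norm_num) (by norm_num)

theorem sierpinski_β (i : ℕ) : sierpinski.β i ↔ i ≠ 0 := by
  by_cases h : i = 0 <;> simp [sierpinski, h]

/-- All radii `2⁻ᵐ` are at most `1` and distances are `0` or `1`, so only the centre matters: a ball
is `{⊤}` or the whole space. -/
theorem sierpinski_mem_B {n : ℕ} {U : Set Prop} :
    U ∈ sierpinski.space.B n ↔ U = {y | n.unpair.1 ≠ 0 → y} := by
  have : sierpinski.ball (sierpinski.β n.unpair.1) ((1 / 2) ^ n.unpair.2) =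
      {y | n.unpair.1 ≠ 0 → y} := by
    ext y
    exact (sierpinski_delta_lt (half_pow_pos _) (half_pow_le _)).trans (by rw [sierpinski_β]; rfl)
  rw [← this]
  exact Part.mem_some_iff

theorem sierpinski_mem_conj_B {n : ℕ} {U : Set Prop} :
    U ∈ sierpinski.conj.space.B n ↔ U = {y | y → n.unpair.1 ≠ 0} := by
  have : sierpinski.conj.ball (sierpinski.β n.unpair.1) ((1 / 2) ^ n.unpair.2) =
      {y | y → n.unpair.1 ≠ 0} := by
    ext y
    exact (sierpinski_delta_lt (half_pow_pos _) (half_pow_le _)).trans (by rw [sierpinski_β]; rfl)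
  rw [← this]
  exact Part.mem_some_iff

theorem sierpinski_Mem {n : ℕ} {y : Prop} :
    sierpinski.space.Mem y n ↔ (n.unpair.1 ≠ 0 → y) := by
  simp [IndexedSpace.Mem, sierpinski_mem_B]

theorem sierpinski_conj_Mem {n : ℕ} {y : Prop} :
    sierpinski.conj.space.Mem y n ↔ (y → n.unpair.1 ≠ 0) := by
  simp [IndexedSpace.Mem, sierpinski_mem_conj_B]

theorem sierpinski_topology : sierpinski.topology = sierpinskiSpace := by
  refine TopologicalSpace.ext_iff.2 fun U => ?_
  have h1 : @IsOpen _ sierpinski.topology U ↔ (False ∈ U → True ∈ U) := by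
    constructor
    · intro h hF
      obtain ⟨r, hr, hU⟩ := h False hF
      refine hU ?_
      change sierpinski.δ False True < r
      simpa [sierpinski] using hr
    · intro h x hx
      refine ⟨1, one_pos, fun y hy => ?_⟩
      have hy' := (sierpinski_delta_lt one_pos le_rfl).1 hy
      by_cases h1 : x <;> by_cases h2 : y <;> simp_all
  -- Mathlib generates this topology from `{True}`; the condition passes to all open sets by
  -- induction on the generation.
  have h2 : @IsOpen _ sierpinskiSpace U ↔ (False ∈ U → True ∈ U) := by
    constructor
    · intro h hF
      have : Specializes (True : Prop) False := by
        rw [specializes_iff_forall_open]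
        intro s hs hFs
        induction hs with
        | basic s hs => simp_all
        | univ => trivial
        | inter s t _ _ h1 h2 => exact ⟨h1 hFs.1, h2 hFs.2⟩
        | sUnion S _ h1 =>
          obtain ⟨t, ht, hFt⟩ := hFs
          exact ⟨t, ht, h1 t ht hFt⟩
      exact this.mem_open h hF
    · intro h
      by_cases hF : False ∈ U
      · have : U = univ := by
          ext y
          by_cases hy : y <;> simp_all
        rw [this]
        exact isOpen_univ
      · by_cases hT : True ∈ U
        · have : U = {True} := by
            ext y
            by_cases hy : y <;> simp_all
          rw [this]
          exact isOpen_singleton_true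
        · have : U = ∅ := by
            ext y
            by_cases hy : y <;> simp_all
          rw [this]
          exact isOpen_empty
  rw [h1, h2]

theorem primrec_two_pow : Primrec fun n : ℕ => 2 ^ n := by
  refine (Primrec.nat_rec₁ 1 (f := fun _ y => 2 * y)
    (Primrec.nat_double.comp Primrec.snd).to₂).of_eq fun n => ?_
  induction n with
  | zero => rfl
  | succ n ih => simp only [ih, pow_succ']

theorem sierpinski_delta_eq (y z : Prop) : sierpinski.δ y z = 0 ∧ (y → z) ∨
    sierpinski.δ y z = 1 ∧ ¬ (y → z) := by
  by_cases hy : y <;> by_cases hz : z <;> simp [sierpinski, hy, hz]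

theorem primrecPred_eq_const {α : Type*} [Primcodable α] {f : α → ℕ} (hf : Primrec f) (k : ℕ) :
    PrimrecPred fun a => f a = k :=
  Primrec.eq.comp hf (Primrec.const k)

/-- Distances are `0` or `1`, so comparing one with `c * 2⁻ᵉ` reduces to comparing `c` with `0` or
with `2 ^ e`. -/
theorem sierpinski_isComputable : sierpinski.IsComputable := by
  have h1 : Primrec fun p : ℕ × ℕ × ℕ × ℕ => p.1 := Primrec.fst
  have h2 : Primrec fun p : ℕ × ℕ × ℕ × ℕ => p.2.1 := Primrec.fst.comp Primrec.snd
  have h3 : Primrec fun p : ℕ × ℕ × ℕ × ℕ => p.2.2.1 :=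
    Primrec.fst.comp (Primrec.snd.comp Primrec.snd)
  have h4 : Primrec fun p : ℕ × ℕ × ℕ × ℕ => p.2.2.2 :=
    Primrec.snd.comp (Primrec.snd.comp Primrec.snd)
  have hle : PrimrecPred fun p : ℕ × ℕ × ℕ × ℕ => p.1 = 0 ∨ ¬ p.2.1 = 0 :=
    (primrecPred_eq_const h1 0).or (primrecPred_eq_const h2 0).not
  have key : ∀ (c e : ℕ), (1 < (c : ℝ) * (1 / 2) ^ e ↔ 2 ^ e < c) ∧
      ((c : ℝ) * (1 / 2) ^ e < 1 ↔ c < 2 ^ e) := by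
    intro c e
    have h0 : (0 : ℝ) < 2 ^ e := by positivity
    rw [one_div, inv_pow, ← div_eq_mul_inv, lt_div_iff₀ h0, div_lt_iff₀ h0, one_mul]
    constructor <;> norm_cast
  constructor
  · refine (primrecPred_re (PrimrecPred.or (hle.and (primrecPred_eq_const h3 0).not)
      (hle.not.and (Primrec.nat_lt.comp (primrec_two_pow.comp h4) h3)))).of_eq ?_
    rintro ⟨a, b, c, e⟩
    have hc : (0 : ℝ) < c * (1 / 2) ^ e ↔ c ≠ 0 := by
      rw [mul_pos_iff_of_pos_right (half_pow_pos e)]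
      exact_mod_cast Nat.pos_iff_ne_zero
    have h := sierpinski_delta_eq (sierpinski.β a) (sierpinski.β b)
    change (((a = 0 ∨ ¬ b = 0) ∧ ¬ c = 0) ∨ (¬ (a = 0 ∨ ¬ b = 0) ∧ 2 ^ e < c)) ↔
      sierpinski.δ (sierpinski.β a) (sierpinski.β b) < (c : ℝ) * (1 / 2) ^ e
    rcases h with ⟨h, h'⟩ | ⟨h, h'⟩ <;> rw [sierpinski_β, sierpinski_β] at h'
    · rw [h, hc]
      simp [or_iff_not_imp_left.2 h']
    · rw [h, (key c e).1]
      simp [mt or_iff_not_imp_left.1 h']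
  · refine (primrecPred_re (hle.not.and (Primrec.nat_lt.comp h3
      (primrec_two_pow.comp h4)))).of_eq ?_
    rintro ⟨a, b, c, e⟩
    have hc : ¬ (c * (1 / 2) ^ e < (0 : ℝ)) := not_lt.2 (by positivity)
    have h := sierpinski_delta_eq (sierpinski.β a) (sierpinski.β b)
    change (¬ (a = 0 ∨ ¬ b = 0) ∧ c < 2 ^ e) ↔
      (c : ℝ) * (1 / 2) ^ e < sierpinski.δ (sierpinski.β a) (sierpinski.β b)
    rcases h with ⟨h, h'⟩ | ⟨h, h'⟩ <;> rw [sierpinski_β, sierpinski_β] at h'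
    · simp only [h, hc, or_iff_not_imp_left.2 h', not_true, false_and]
    · rw [h, (key c e).2]
      simp [mt or_iff_not_imp_left.1 h']

theorem computable_natUnpair {α : Type*} [Primcodable α] {f : α → ℕ} (hf : Computable f) :
    Computable fun a => (f a).unpair :=
  Primrec.unpair.to_comp.comp hf

/-- In a computable quasi-metric space the approximations to the points `β k` are uniformly
computably enumerable. -/
theorem re_approx_β {X : Type*} {q : SepQuasiMetric X} (h : q.IsComputable) :
    REPred fun p : ℕ × ℕ => p.2 ∈ q.approx (q.β p.1) := by
  have hu := computable_natUnpair (Computable.snd (α := ℕ) (β := ℕ))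
  have hv := computable_natUnpair (Computable.fst.comp hu)
  have h1 := re_comp h.1 ((Computable.fst.comp hv).pair (Computable.fst.pair
    ((Computable.const 1).pair (Computable.snd.comp hu))))
  have h2 := re_comp h.1 (Computable.fst.pair ((Computable.snd.comp hv).pair
    ((Computable.const 1).pair (Computable.snd.comp hu))))
  refine (re_and h1 h2).of_eq fun p => ?_
  simp [SepQuasiMetric.approx]

theorem β_mem_computablePoints {X : Type*} {q : SepQuasiMetric X} (h : q.IsComputable) (k : ℕ) :
    q.β k ∈ q.computablePoints :=
  re_comp (f := fun n => (k, n)) (re_approx_β h) ((Computable.const k).pair Computable.id)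

theorem sierpinski_computablePoints : sierpinski.computablePoints = Set.univ := by
  refine eq_univ_of_forall fun y => ?_
  have h := β_mem_computablePoints sierpinski_isComputable
  by_cases hy : y
  · have e : sierpinski.β 1 = y := propext ((sierpinski_β 1).trans (by simp [hy]))
    exact e ▸ h 1
  · have e : sierpinski.β 0 = y := propext ((sierpinski_β 0).trans (by simp [hy]))
    exact e ▸ h 0

/-! ### Naming truth values by the halting problem -/

/-- The numbering of the truth values for which `i` is an index of the proposition `0 ∈ W i`. -/
def haltNumbering : PNumbering Prop where
  toFun i := Part.some (0 ∈ W i)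
  surj y := by
    have h : REPred fun n : ℕ => n ∈ {_n : ℕ | y} := by
      by_cases hy : y
      · exact (primrecPred_re (primrecPred_eq_const (Primrec.const 0) 0)).of_eq (by simp [hy])
      · exact (primrecPred_re (primrecPred_eq_const (Primrec.const 1) 0)).of_eq (by simp [hy])
    obtain ⟨i, hi⟩ := exists_W_eq h
    exact ⟨i, by simp [hi]⟩

theorem mem_haltNumbering {i : ℕ} {y : Prop} : y ∈ haltNumbering.toFun i ↔ (y ↔ 0 ∈ W i) :=
  Part.mem_some_iff.trans ⟨fun h => by rw [h], propext⟩

/-- By s-m-n, `W (f i)` can be made all of `ℕ` or empty according to `R i`. This is how effective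
operators into the numbering are obtained. -/
theorem exists_halt_index {R : ℕ → Prop} (hR : REPred R) :
    ∃ f : ℕ → ℕ, Computable f ∧ ∀ i, R i ∈ haltNumbering.toFun (f i) := by
  obtain ⟨f, hf, h⟩ := exists_index (R := fun a _ => R a) (re_comp hR Computable.fst)
  exact ⟨f, hf, fun i => mem_haltNumbering.2 (by simp [h])⟩

theorem primrecPred_center_zero : PrimrecPred fun p : ℕ × ℕ => p.2.unpair.1 = 0 :=
  primrecPred_eq_const (Primrec.fst.comp (Primrec.unpair.comp Primrec.snd)) 0

theorem sierpinski_isComputable_halt : sierpinski.space.IsComputable haltNumbering := by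
  have h0 : REPred fun p : ℕ × ℕ => 0 ∈ W p.1 :=
    re_comp (f := fun p : ℕ × ℕ => (p.1, 0)) re_mem_W
      (Computable.fst.pair (Computable.const 0))
  refine ⟨fun p => p.2.unpair.1 = 0 ∨ 0 ∈ W p.1,
    re_or (primrecPred_re primrecPred_center_zero) h0, fun i y hy n _ => ?_⟩
  rw [sierpinski_Mem, mem_haltNumbering.1 hy]
  tauto

/-- A normed enumeration converges to `⊤` exactly if one of its values has centre `⊤`, and this is
enumerable in its index. -/
theorem sierpinski_isAcceptable_halt : sierpinski.space.IsAcceptable haltNumbering := by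
  refine ⟨?_, sierpinski_isComputable_halt⟩
  have hR : REPred fun m : ℕ => ∃ a v, v ∈ phi m a ∧ v.unpair.1 ≠ 0 := by
    refine re_exists (re_exists (R := fun (p : ℕ × ℕ) v => v ∈ phi p.1 p.2 ∧ v.unpair.1 ≠ 0) ?_)
    exact re_and re_mem_phi (primrecPred_re (primrecPred_eq_const
      (Primrec.fst.comp (Primrec.unpair.comp Primrec.snd)) 0).not)
  obtain ⟨f, hf, h⟩ := exists_halt_index hR
  refine ⟨fun m => Part.some (f m), hf, fun m y hm => ⟨f m, Part.mem_some _, ?_⟩⟩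
  obtain ⟨g, hg, -, hmem, hconv⟩ := hm
  refine mem_haltNumbering.2 (Iff.trans ⟨fun hy => ?_, ?_⟩ (mem_haltNumbering.1 (h m)))
  · obtain ⟨a, ha⟩ := hconv (Nat.pair 1 0) (sierpinski_Mem.2 fun _ => hy)
    refine ⟨a, g a, hg a, ?_⟩
    -- The value `g a` refines the ball `{⊤}` of radius `2⁰`; distance below `1` from `⊤` forces its
    -- centre to be `⊤`.
    have h1 : sierpinski.δ (sierpinski.β 1) (sierpinski.β (g a).unpair.1) < 1 := by
      have h2 : sierpinski.δ (sierpinski.β (Nat.pair 1 0).unpair.1)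
        (sierpinski.β (g a).unpair.1) + (1 / 2) ^ (g a).unpair.2 <
          (1 / 2 : ℝ) ^ (Nat.pair 1 0).unpair.2 := ha
      simp only [Nat.unpair_pair, pow_zero] at h2
      linarith [half_pow_pos (g a).unpair.2]
    rw [sierpinski_delta_lt one_pos le_rfl, sierpinski_β, sierpinski_β] at h1
    exact h1 one_ne_zero
  · rintro ⟨a, v, hv, hv0⟩
    obtain rfl := Part.mem_unique hv (hg a)
    exact sierpinski_Mem.1 (hmem a) hv0

theorem sierpinski_conj_not_isComputable_halt :
    ¬ sierpinski.conj.space.IsComputable haltNumbering := by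
  rintro ⟨L, hL, h⟩
  refine ComputablePred.halting_problem_not_re 0 ?_
  -- The code `Nat.pair 0 0` denotes the conjugate ball `{⊥}`, so this enumerates the programs that
  -- diverge on `0`.
  refine (re_comp hL ((Computable.encode (α := Nat.Partrec.Code)).pair
    (Computable.const (Nat.pair 0 0)))).of_eq fun c => ?_
  rw [h (Encodable.encode c) _ (Part.mem_some _) _ trivial, sierpinski_conj_Mem]
  simp [W, phi]

/-- If complements of basic `τ`-sets are uniformly Lacombe for `σ`, a basic set can serve as its own
smaller neighbourhood. -/
theorem effectivelyRegular_of_index {T : Type*} {τ σ : IndexedSpace T} (x : PNumbering T)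
    {A : ℕ → Set ℕ} (hA : REPred fun p : ℕ × ℕ => p.2 ∈ A p.1)
    (h : ∀ m, ∀ U ∈ τ.B m, (∀ a ∈ A m, (σ.B a).Dom) ∧ Uᶜ = {y | ∃ a ∈ A m, σ.Mem y a}) :
    EffectivelyRegular τ σ x := by
  obtain ⟨f, hf, hW⟩ := exists_index (R := fun m a => a ∈ A m) hA
  refine ⟨fun p => Part.some p.2, fun p => Part.some (f p.2), Computable.snd,
    hf.comp Computable.snd, fun i y _ m U hU hy => ?_⟩
  obtain ⟨h1, h2⟩ := h m U hU
  refine ⟨m, Part.mem_some _, U, hU, f m, Part.mem_some _, Uᶜ, ?_, hy, subset_rfl, subset_rfl,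
    inter_compl_self U⟩
  refine ⟨fun a ha => h1 a ((hW m).le ha), ?_⟩
  change {y | ∃ a ∈ W (f m), σ.Mem y a} = _
  rw [hW, h2]
  rfl

theorem sierpinski_isEffectivelyPairwiseRegular (x : PNumbering Prop) :
    sierpinski.biSpace.IsEffectivelyPairwiseRegular x := by
  have h0 : PrimrecPred fun p : ℕ × ℕ => p.1.unpair.1 = 0 :=
    primrecPred_eq_const (Primrec.fst.comp (Primrec.unpair.comp Primrec.fst)) 0
  constructor
  · refine effectivelyRegular_of_index x (A := fun m => {a | m.unpair.1 ≠ 0 ∧ a.unpair.1 = 0})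
      (primrecPred_re (h0.not.and primrecPred_center_zero)) fun m U hU =>
        ⟨fun _ _ => trivial, ?_⟩
    obtain rfl := sierpinski_mem_B.1 hU
    ext y
    change _ ↔ ∃ a ∈ _, sierpinski.conj.space.Mem y a
    simp only [sierpinski_conj_Mem, mem_compl_iff, mem_ofPred_eq, not_forall]
    constructor
    · rintro ⟨h1, h2⟩
      exact ⟨Nat.pair 0 0, by simp [h1], fun h => absurd h h2⟩
    · rintro ⟨a, ⟨h1, h2⟩, h3⟩
      exact ⟨h1, fun hy => h3 hy h2⟩
  · refine effectivelyRegular_of_index x (A := fun m => {a | m.unpair.1 = 0 ∧ ¬ a.unpair.1 = 0})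
      (primrecPred_re (h0.and primrecPred_center_zero.not)) fun m U hU =>
        ⟨fun _ _ => trivial, ?_⟩
    obtain rfl := sierpinski_mem_conj_B.1 hU
    ext y
    change _ ↔ ∃ a ∈ _, sierpinski.space.Mem y a
    simp only [sierpinski_Mem, mem_compl_iff, mem_ofPred_eq, not_forall, not_not]
    constructor
    · rintro ⟨h1, h2⟩
      exact ⟨Nat.pair 1 0, by simp [h2], fun _ => h1⟩
    · rintro ⟨a, ⟨h1, h2⟩, h3⟩
      exact ⟨h3 h2, h1⟩

/-! ### The computable points of a computable metric space -/

section Metric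

variable {X : Type*} {q : SepQuasiMetric X}

theorem conj_eq_self (hs : ∀ y z, q.δ y z = q.δ z y) : q.conj = q := by
  obtain ⟨⟨δ, _, _, _, _⟩, β, _⟩ := q
  have : (fun x y => δ y x) = δ := by
    funext x y
    exact (hs x y).symm
  simp only [SepQuasiMetric.conj, QuasiMetric.conj, this]

theorem mem_xc {i : ℕ} {y : q.computablePoints} : y ∈ q.xc.toFun i ↔ W i = q.approx y := by
  constructor
  · rintro ⟨h, rfl⟩
    exact h.choose_spec
  · intro hi
    have h : ∃ y : q.computablePoints, W i = q.approx y := ⟨y, hi⟩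
    exact ⟨h, Subtype.ext (q.approx_injective (h.choose_spec.symm.trans hi))⟩

theorem restrict_Mem {y : q.computablePoints} {n : ℕ} :
    (q.space.restrict q.computablePoints).Mem y n ↔
      q.δ (q.β n.unpair.1) y < (1 / 2) ^ n.unpair.2 := by
  constructor
  · rintro ⟨_, hU, hy⟩
    obtain ⟨V, hV, rfl⟩ := (Part.mem_map_iff _).1 hU
    obtain rfl := Part.mem_some_iff.1 hV
    exact hy
  · intro h
    exact ⟨_, Part.mem_map _ (Part.mem_some _), h⟩

theorem re_prec (hc : q.IsComputable) : REPred fun p : ℕ × ℕ => q.space.prec p.1 p.2 := by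
  have hk := computable_natUnpair (Computable.fst (α := ℕ) (β := ℕ))
  have hl := computable_natUnpair (Computable.snd (α := ℕ) (β := ℕ))
  -- For radii `2⁻ᵐ ≺ 2⁻ⁿ` the condition `δ + 2⁻ᵐ < 2⁻ⁿ` is `δ < (2 ^ (m - n) - 1) * 2⁻ᵐ` when `n ≤
  -- m`. For `m ≤ n` truncated subtraction makes the factor `0`, and both conditions fail.
  have hr : Computable fun p : ℕ × ℕ => 2 ^ (p.1.unpair.2 - p.2.unpair.2) - 1 :=
    Primrec.nat_sub.to_comp.comp (primrec_two_pow.to_comp.comp (Primrec.nat_sub.to_comp.comp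
      (Computable.snd.comp hk) (Computable.snd.comp hl))) (Computable.const 1)
  refine (re_comp hc.1 ((Computable.fst.comp hl).pair ((Computable.fst.comp hk).pair
    (hr.pair (Computable.snd.comp hk))))).of_eq ?_
  rintro ⟨k, l⟩
  obtain ⟨⟨a, m⟩, rfl⟩ := Nat.pairEquiv.surjective k
  obtain ⟨⟨b, n⟩, rfl⟩ := Nat.pairEquiv.surjective l
  simp only [SepQuasiMetric.space, Nat.pairEquiv_apply, Function.uncurry, Nat.unpair_pair]
  rcases le_total m n with h | h
  · have h1 : (1 / 2 : ℝ) ^ n ≤ (1 / 2) ^ m :=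
      pow_le_pow_of_le_one (by norm_num) (by norm_num) h
    have h2 := q.nonneg (q.β b) (q.β a)
    rw [Nat.sub_eq_zero_of_le h]
    simp only [pow_zero, Nat.sub_self, Nat.cast_zero, zero_mul]
    exact ⟨fun h' => absurd h' (not_lt.2 h2), fun h' => by linarith⟩
  · obtain ⟨d, rfl⟩ := Nat.exists_eq_add_of_le h
    rw [Nat.add_sub_cancel_left, Nat.cast_sub Nat.one_le_two_pow, pow_add]
    push_cast
    have h1 : (2 : ℝ) ^ d * (1 / 2) ^ d = 1 := by rw [← mul_pow]; norm_num
    rw [show ((2 : ℝ) ^ d - 1) * ((1 / 2) ^ n * (1 / 2) ^ d) =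
      (1 / 2) ^ n * (2 ^ d * (1 / 2) ^ d) - (1 / 2) ^ n * (1 / 2) ^ d by ring, h1, mul_one]
    exact lt_sub_iff_add_lt

/-- The element of `approx y` which says that `y` lies in the `n`-th basic open set. -/
def ballCode (n : ℕ) : ℕ := Nat.pair (Nat.pair n.unpair.1 n.unpair.1) n.unpair.2

theorem primrec_ballCode : Primrec ballCode :=
  Primrec₂.natPair.comp (Primrec₂.natPair.comp (Primrec.fst.comp Primrec.unpair)
    (Primrec.fst.comp Primrec.unpair)) (Primrec.snd.comp Primrec.unpair)

/-- With equal centres, symmetry merges the two inequalities defining `approx`, so ball membership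
can be read off any index of the point. -/
theorem ballCode_mem_approx (hs : ∀ y z, q.δ y z = q.δ z y) {n : ℕ} {y : X} :
    ballCode n ∈ q.approx y ↔ q.δ (q.β n.unpair.1) y < (1 / 2) ^ n.unpair.2 := by
  simp [SepQuasiMetric.approx, ballCode, hs y]

theorem ballCode_mem_W (hs : ∀ y z, q.δ y z = q.δ z y) {i n : ℕ} {y : q.computablePoints}
    (hy : y ∈ q.xc.toFun i) :
    ballCode n ∈ W i ↔ (q.space.restrict q.computablePoints).Mem y n := by
  rw [mem_xc.1 hy, ballCode_mem_approx hs, restrict_Mem]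

theorem re_ballCode_mem_W : REPred fun p : ℕ × ℕ => ballCode p.2 ∈ W p.1 :=
  re_comp (f := fun p : ℕ × ℕ => (p.1, ballCode p.2)) re_mem_W
    (Computable.fst.pair (primrec_ballCode.to_comp.comp Computable.snd))

theorem xc_isComputable (hs : ∀ y z, q.δ y z = q.δ z y) :
    (q.space.restrict q.computablePoints).IsComputable q.xc :=
  ⟨_, re_ballCode_mem_W, fun _ _ hy _ _ => ballCode_mem_W hs hy⟩

theorem re_common_refinement {M P : ℕ → ℕ → Prop} (hM : REPred fun p : ℕ × ℕ => M p.1 p.2)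
    (hP : REPred fun p : ℕ × ℕ => P p.1 p.2) :
    REPred fun p : (ℕ × ℕ × ℕ) × ℕ => M p.1.1 p.2 ∧ P p.2 p.1.2.1 ∧ P p.2 p.1.2.2 := by
  have h1 : Computable fun p : (ℕ × ℕ × ℕ) × ℕ => (p.1.1, p.2) :=
    (Computable.fst.comp Computable.fst).pair Computable.snd
  have h2 : Computable fun p : (ℕ × ℕ × ℕ) × ℕ => (p.2, p.1.2.1) :=
    Computable.snd.pair (Computable.fst.comp (Computable.snd.comp Computable.fst))
  have h3 : Computable fun p : (ℕ × ℕ × ℕ) × ℕ => (p.2, p.1.2.2) :=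
    Computable.snd.pair (Computable.snd.comp (Computable.snd.comp Computable.fst))
  have k1 := re_comp hM h1
  have k2 := re_comp hP h2
  have k3 := re_comp hP h3
  exact re_and k1 (re_and k2 k3)

theorem xc_isEffective (hs : ∀ y z, q.δ y z = q.δ z y) (hc : q.IsComputable) :
    (q.space.restrict q.computablePoints).IsEffective q.xc := by
  refine ⟨fun _ => trivial, ?_⟩
  obtain ⟨s, hs1, hs2, hs3⟩ := re_select (R := fun (p : ℕ × ℕ × ℕ) a =>
    ballCode a ∈ W p.1 ∧ q.space.prec a p.2.1 ∧ q.space.prec a p.2.2) 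
    (re_common_refinement (M := fun i a => ballCode a ∈ W i) (P := q.space.prec)
      re_ballCode_mem_W (re_prec hc))
  refine ⟨s, hs1, fun i y hy m n hm hn => ?_⟩
  obtain ⟨a, ha, ham, han⟩ := (q.space.restrict q.computablePoints).strong y m n hm hn
  have hd : (s (i, m, n)).Dom := (hs3 _).2 ⟨a, (ballCode_mem_W hs hy).2 ha, ham, han⟩
  obtain ⟨hb, hbm, hbn⟩ := hs2 _ _ (Part.get_mem hd)
  exact ⟨_, Part.get_mem hd, (ballCode_mem_W hs hy).1 hb, hbm, hbn⟩

theorem computable_natPair {α : Type*} [Primcodable α] {f g : α → ℕ} (hf : Computable f)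
    (hg : Computable g) : Computable fun a => Nat.pair (f a) (g a) :=
  Primrec₂.natPair.to_comp.comp hf hg

/-- A ball contains the limit exactly if some enumerated value lies strongly inside it: convergence
gives one direction, `prec_subset` the other. Hence `approx y` is enumerable from the index `m`. -/
theorem mem_approx_iff_of_convergesTo (hs : ∀ y z, q.δ y z = q.δ z y) {m : ℕ}
    {y : q.computablePoints} (hm : (q.space.restrict q.computablePoints).ConvergesTo m y) (t : ℕ) :
    t ∈ q.approx y ↔
      (∃ a v, v ∈ phi m a ∧ q.space.prec v (Nat.pair t.unpair.1.unpair.1 t.unpair.2)) ∧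
      ∃ a v, v ∈ phi m a ∧ q.space.prec v (Nat.pair t.unpair.1.unpair.2 t.unpair.2) := by
  have key : ∀ b e, q.δ (q.β b) y < (1 / 2) ^ e ↔
      ∃ a v, v ∈ phi m a ∧ q.space.prec v (Nat.pair b e) := by
    intro b e
    obtain ⟨f, hf, -, hmem, hconv⟩ := hm
    have hn : (q.space.restrict q.computablePoints).Mem y (Nat.pair b e) ↔
        q.δ (q.β b) y < (1 / 2) ^ e := by
      rw [restrict_Mem, Nat.unpair_pair]
    rw [← hn]
    constructor
    · intro h
      obtain ⟨a, ha⟩ := hconv _ h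
      exact ⟨a, f a, hf a, ha⟩
    · rintro ⟨a, v, hv, h⟩
      obtain rfl := Part.mem_unique hv (hf a)
      obtain ⟨U, hU, hyU⟩ := hmem a
      exact ⟨_, Part.mem_map _ (Part.mem_some _),
        (q.space.restrict q.computablePoints).prec_subset h U hU _
          (Part.mem_map _ (Part.mem_some _)) hyU⟩
  rw [← key, ← key, SepQuasiMetric.approx, mem_ofPred_eq, hs y]

theorem re_reached {P : ℕ → ℕ → Prop} (hP : REPred fun p : ℕ × ℕ => P p.1 p.2) :
    REPred fun p : ℕ × ℕ => ∃ a v, v ∈ phi p.1 a ∧ P v p.2 := by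
  have h1 : Computable fun p : ((ℕ × ℕ) × ℕ) × ℕ => ((p.1.1.1, p.1.2), p.2) :=
    ((Computable.fst.comp (Computable.fst.comp Computable.fst)).pair
      (Computable.snd.comp Computable.fst)).pair Computable.snd
  have h2 : Computable fun p : ((ℕ × ℕ) × ℕ) × ℕ => (p.2, p.1.1.2) :=
    Computable.snd.pair (Computable.snd.comp (Computable.fst.comp Computable.fst))
  have k1 := re_comp re_mem_phi h1
  have k2 := re_comp hP h2
  exact re_exists (re_exists (R := fun (p : (ℕ × ℕ) × ℕ) v => v ∈ phi p.1.1 p.2 ∧ P v p.1.2)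
    (re_and k1 k2))

theorem re_reached_pair {P : ℕ → ℕ → Prop} (hP : REPred fun p : ℕ × ℕ => P p.1 p.2) :
    REPred fun p : ℕ × ℕ =>
      (∃ a v, v ∈ phi p.1 a ∧ P v (Nat.pair p.2.unpair.1.unpair.1 p.2.unpair.2)) ∧
      ∃ a v, v ∈ phi p.1 a ∧ P v (Nat.pair p.2.unpair.1.unpair.2 p.2.unpair.2) := by
  have hu := computable_natUnpair (Computable.snd (α := ℕ) (β := ℕ))
  have hv := computable_natUnpair (Computable.fst.comp hu)
  have h1 := re_comp (re_reached hP) (Computable.fst.pair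
    (computable_natPair (Computable.fst.comp hv) (Computable.snd.comp hu)))
  have h2 := re_comp (re_reached hP) (Computable.fst.pair
    (computable_natPair (Computable.snd.comp hv) (Computable.snd.comp hu)))
  exact re_and h1 h2

theorem xc_allowsLimitPassing (hs : ∀ y z, q.δ y z = q.δ z y) (hc : q.IsComputable) :
    (q.space.restrict q.computablePoints).AllowsLimitPassing q.xc := by
  obtain ⟨f, hf, hW⟩ := exists_index (R := fun m t =>
      (∃ a v, v ∈ phi m a ∧ q.space.prec v (Nat.pair t.unpair.1.unpair.1 t.unpair.2)) ∧
      ∃ a v, v ∈ phi m a ∧ q.space.prec v (Nat.pair t.unpair.1.unpair.2 t.unpair.2))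
    (re_reached_pair (P := q.space.prec) (re_prec hc))
  refine ⟨fun m => Part.some (f m), hf, fun m y hm => ⟨f m, Part.mem_some _, mem_xc.2 ?_⟩⟩
  rw [hW]
  ext t
  exact (mem_approx_iff_of_convergesTo hs hm t).symm

theorem xc_isComputablyBiSeparable (hc : q.IsComputable) (hβ : Function.Surjective q.β) :
    q.computableBiSpace.IsComputablyBiSeparable q.xc := by
  obtain ⟨f, hf, hW⟩ := exists_index (R := fun k t => t ∈ q.approx (q.β k)) (re_approx_β hc)
  have hx : ∀ k, ⟨q.β k, β_mem_computablePoints hc k⟩ ∈ q.xc.toFun (f k) :=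
    fun k => mem_xc.2 (hW k)
  -- As `β` is onto, the enumerated points exhaust the space and density is trivial.
  have hu : {y | ∃ i, (∃ k, f k = i) ∧ y ∈ q.xc.toFun i} = Set.univ := by
    refine eq_univ_of_forall fun y => ?_
    obtain ⟨k, hk⟩ := hβ y
    exact ⟨f k, ⟨k, rfl⟩, (Subtype.ext hk : (⟨q.β k, _⟩ : q.computablePoints) = y) ▸ hx k⟩
  refine ⟨fun i => ∃ k, f k = i, ?_, ?_, ?_, ?_⟩
  · refine re_exists (re_comp (f := fun p : ℕ × ℕ => (f p.2, p.1))
      (primrecPred_re (Primrec.eq (α := ℕ))) ?_)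
    exact (hf.comp Computable.snd).pair Computable.fst
  · rintro _ ⟨k, rfl⟩
    exact Part.dom_iff_mem.2 ⟨_, hx k⟩
  · rw [hu]
    exact @dense_univ _ q.computableBiSpace.τ.top
  · rw [hu]
    exact @dense_univ _ q.computableBiSpace.σ.top

theorem computableBiSpace_eq (hs : ∀ y z, q.δ y z = q.δ z y) :
    q.computableBiSpace =
      ⟨q.space.restrict q.computablePoints, q.space.restrict q.computablePoints⟩ := by
  simp only [SepQuasiMetric.computableBiSpace, SepQuasiMetric.biSpace, BiSpace.restrict,
    conj_eq_self hs]

theorem xc_isBiEffective (hs : ∀ y z, q.δ y z = q.δ z y) (hc : q.IsComputable) :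
    q.computableBiSpace.IsBiEffective q.xc := by
  rw [computableBiSpace_eq hs]
  exact ⟨xc_isEffective hs hc, xc_isEffective hs hc⟩

theorem xc_isBiAcceptable (hs : ∀ y z, q.δ y z = q.δ z y) (hc : q.IsComputable) :
    q.computableBiSpace.IsBiAcceptable q.xc := by
  rw [computableBiSpace_eq hs]
  refine ⟨?_, xc_isComputable hs, xc_isComputable hs⟩
  obtain ⟨pt, hpt, h⟩ := xc_allowsLimitPassing hs hc
  -- Both topologies coincide, so the first enumeration already determines the limit.
  refine ⟨fun t => pt t.unpair.1, hpt.comp (Computable.fst.comp Primrec.unpair.to_comp), ?_⟩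
  intro m n y hm _
  simpa only [Nat.unpair_pair] using h m y hm

end Metric

/-! ### Effective continuity implies continuity at the basic open sets -/

theorem EffectivelyContinuous.isOpen_preimage {T T' : Type*} {τ : IndexedSpace T}
    {τ' : IndexedSpace T'} {F : T → T'} (h : EffectivelyContinuous τ τ' F) {n : ℕ} {V : Set T'}
    (hV : V ∈ τ'.B n) : @IsOpen _ τ.top (F ⁻¹' V) := by
  let := τ.top
  obtain ⟨g, -, hg⟩ := h
  obtain ⟨a, -, hd, e⟩ := hg n V hV
  rw [← e]
  refine τ.isBasis.isOpen_iff.2 ?_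
  rintro y ⟨b, hb, U, hU, hy⟩
  exact ⟨U, ⟨b, hU⟩, hy, fun z hz => ⟨b, hb, U, hU, hz⟩⟩

/-! ### A discontinuous effective operator -/

/-- The level of a nonzero number, its distance to `0` in `sequenceSpace` being `2⁻ˡ`. -/
def level (a : ℕ) : ℕ := a.pred.unpair.1

/-- The distance to `0`. -/
noncomputable def weight (a : ℕ) : ℝ := if a = 0 then 0 else (1 / 2) ^ level a

theorem weight_nonneg (a : ℕ) : 0 ≤ weight a := by
  unfold weight
  split_ifs <;> positivity

theorem weight_eq_zero {a : ℕ} (h : weight a = 0) : a = 0 := by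
  by_contra ha
  rw [weight, if_neg ha] at h
  exact (half_pow_pos _).ne' h

/-- An ultrametric space on the natural numbers in which infinitely many sequences of
equidistant points converge to `0` simultaneously: for each level `l`, there are infinitely many
points at distance `2⁻ˡ` from `0` and from each other. -/
noncomputable def sequenceSpace : SepQuasiMetric ℕ where
  δ a b := if a = b then 0 else max (weight a) (weight b)
  nonneg a b := by
    split_ifs
    · exact le_rfl
    · exact le_max_of_le_left (weight_nonneg a)
  self a := if_pos rfl
  triangle a b c := by
    have ha := weight_nonneg a
    have hb := weight_nonneg b
    have hc := weight_nonneg c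
    by_cases h1 : a = b
    · simp [h1]
    by_cases h2 : b = c
    · simp [h2]
    simp only [h1, h2, if_false]
    have h3 := le_max_left (weight a) (weight b)
    have h4 := le_max_right (weight b) (weight c)
    split_ifs
    · linarith
    · exact max_le (by linarith) (by linarith)
  eq_of a b h _ := by
    by_contra hab
    rw [if_neg hab] at h
    have ha : weight a = 0 := le_antisymm (h ▸ le_max_left _ _) (weight_nonneg a)
    have hb : weight b = 0 := le_antisymm (h ▸ le_max_right _ _) (weight_nonneg b)
    exact hab ((weight_eq_zero ha).trans (weight_eq_zero hb).symm)
  β := id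
  dense := @Function.Surjective.denseRange _ (QuasiMetric.topology _) _ _ Function.surjective_id

theorem sequenceSpace_delta (a b : ℕ) :
    sequenceSpace.δ a b = if a = b then 0 else max (weight a) (weight b) := rfl

theorem sequenceSpace_symm (a b : ℕ) : sequenceSpace.δ a b = sequenceSpace.δ b a := by
  simp only [sequenceSpace_delta, eq_comm (a := a), max_comm (weight a)]

/-- Clearing denominators leaves a decidable comparison of natural numbers. -/
theorem weight_lt {a c e : ℕ} : weight a < (c : ℝ) * (1 / 2) ^ e ↔
    a = 0 ∧ 0 < c ∨ ¬ a = 0 ∧ 2 ^ e < c * 2 ^ level a := by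
  have h0 : (0 : ℝ) < 2 ^ e := by positivity
  have h1 : (0 : ℝ) < 2 ^ level a := by positivity
  by_cases ha : a = 0
  · simp [weight, ha]
  · rw [weight, if_neg ha, one_div, inv_pow, inv_pow, ← div_eq_mul_inv, lt_div_iff₀ h0, mul_comm,
      ← div_eq_mul_inv, div_lt_iff₀ h1]
    simp only [ha, false_and, not_false_iff, true_and, false_or]
    norm_cast

theorem lt_weight {a c e : ℕ} : (c : ℝ) * (1 / 2) ^ e < weight a ↔
    ¬ a = 0 ∧ c * 2 ^ level a < 2 ^ e := by
  have h0 : (0 : ℝ) < 2 ^ e := by positivity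
  have h1 : (0 : ℝ) < 2 ^ level a := by positivity
  by_cases ha : a = 0
  · simp only [weight, ha, if_true, not_true, false_and, iff_false, not_lt]
    positivity
  · rw [weight, if_neg ha, one_div, inv_pow, inv_pow, ← div_eq_mul_inv, div_lt_iff₀ h0, mul_comm,
      ← div_eq_mul_inv, lt_div_iff₀ h1]
    simp only [ha, not_false_iff, true_and]
    norm_cast

theorem primrec_level : Primrec level :=
  Primrec.fst.comp (Primrec.unpair.comp Primrec.pred)

theorem sequenceSpace_isComputable : sequenceSpace.IsComputable := by
  have h1 : Primrec fun p : ℕ × ℕ × ℕ × ℕ => p.1 := Primrec.fst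
  have h2 : Primrec fun p : ℕ × ℕ × ℕ × ℕ => p.2.1 := Primrec.fst.comp Primrec.snd
  have h3 : Primrec fun p : ℕ × ℕ × ℕ × ℕ => p.2.2.1 :=
    Primrec.fst.comp (Primrec.snd.comp Primrec.snd)
  have h4 : Primrec fun p : ℕ × ℕ × ℕ × ℕ => p.2.2.2 :=
    Primrec.snd.comp (Primrec.snd.comp Primrec.snd)
  have heq : PrimrecPred fun p : ℕ × ℕ × ℕ × ℕ => p.1 = p.2.1 := Primrec.eq.comp h1 h2
  have hpos : PrimrecPred fun p : ℕ × ℕ × ℕ × ℕ => 0 < p.2.2.1 :=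
    Primrec.nat_lt.comp (Primrec.const 0) h3
  have hpow := primrec_two_pow.comp h4
  have hmul : ∀ {f : ℕ × ℕ × ℕ × ℕ → ℕ}, Primrec f →
      Primrec fun p => p.2.2.1 * 2 ^ level (f p) := fun hf =>
    Primrec.nat_mul.comp h3 (primrec_two_pow.comp (primrec_level.comp hf))
  have hlt : ∀ {f : ℕ × ℕ × ℕ × ℕ → ℕ}, Primrec f → PrimrecPred fun p =>
      weight (f p) < (p.2.2.1 : ℝ) * (1 / 2) ^ p.2.2.2 := fun hf =>
    (((primrecPred_eq_const hf 0).and hpos).or ((primrecPred_eq_const hf 0).not.and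
      (Primrec.nat_lt.comp hpow (hmul hf)))).of_eq fun _ => weight_lt.symm
  have hgt : ∀ {f : ℕ × ℕ × ℕ × ℕ → ℕ}, Primrec f → PrimrecPred fun p =>
      (p.2.2.1 : ℝ) * (1 / 2) ^ p.2.2.2 < weight (f p) := fun hf =>
    ((primrecPred_eq_const hf 0).not.and
      (Primrec.nat_lt.comp (hmul hf) hpow)).of_eq fun _ => lt_weight.symm
  constructor
  · refine (primrecPred_re ((heq.and hpos).or (heq.not.and ((hlt h1).and (hlt h2))))).of_eq ?_
    rintro ⟨a, b, c, e⟩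
    change _ ↔ sequenceSpace.δ a b < (c : ℝ) * (1 / 2) ^ e
    rw [sequenceSpace_delta]
    by_cases h : a = b
    · simp [h]
    · simp only [h, false_and, not_false_iff, true_and, false_or, if_false, max_lt_iff]
  · refine (primrecPred_re (heq.not.and ((hgt h1).or (hgt h2)))).of_eq ?_
    rintro ⟨a, b, c, e⟩
    change _ ↔ (c : ℝ) * (1 / 2) ^ e < sequenceSpace.δ a b
    rw [sequenceSpace_delta]
    by_cases h : a = b
    · simp only [h, not_true, false_and, if_true, false_iff, not_lt]
      positivity
    · simp only [h, not_false_iff, true_and, if_false, lt_max_iff]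

/-! ### Neighbourhoods of `0` and isolated points -/

theorem sequenceSpace_delta_zero (y : ℕ) : sequenceSpace.δ 0 y = weight y := by
  rw [sequenceSpace_delta]
  by_cases h : y = 0
  · simp [h, weight]
  · rw [if_neg (Ne.symm h)]
    exact max_eq_right ((if_pos rfl : weight 0 = 0).le.trans (weight_nonneg y))

theorem sequenceSpace_near_zero {y n : ℕ} :
    sequenceSpace.δ 0 y < (1 / 2) ^ n ↔ y = 0 ∨ n < level y := by
  rw [sequenceSpace_delta_zero, weight]
  by_cases h : y = 0
  · simp [h]
  · rw [if_neg h, pow_lt_pow_iff_right_of_lt_one₀ (by norm_num) (by norm_num)]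
    simp [h]

theorem sequenceSpace_isolated {p y : ℕ} (hp : p ≠ 0) :
    sequenceSpace.δ p y < (1 / 2) ^ level p ↔ y = p := by
  rw [sequenceSpace_delta]
  by_cases h : p = y
  · simp [h]
  · rw [if_neg h]
    have h1 : (1 / 2) ^ level p ≤ max (weight p) (weight y) :=
      (if_neg hp : weight p = _) ▸ le_max_left (weight p) (weight y)
    exact ⟨fun h2 => absurd h2 (not_lt.2 h1), fun h2 => absurd h2.symm h⟩

theorem mem_sequenceSpace_computablePoints (y : ℕ) : y ∈ sequenceSpace.computablePoints :=
  β_mem_computablePoints sequenceSpace_isComputable y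

/-- A partial computable function that finds a nonzero point of `sequenceSpace` from an
index of it, and that diverges on the indices of `0`. -/
theorem exists_point_of_index : ∃ g : ℕ →. ℕ, Partrec g ∧
    ∀ i, ∀ y ∈ sequenceSpace.xc.toFun i, ∀ p, p ∈ g i ↔ p ≠ 0 ∧ p = y := by
  have hc : Computable fun p : ℕ × ℕ => (p.1, Nat.pair p.2 (level p.2)) :=
    Computable.fst.pair (computable_natPair Computable.snd
      (primrec_level.to_comp.comp Computable.snd))
  have h1 := re_comp re_ballCode_mem_W hc
  obtain ⟨g, hg, hg1, hg2⟩ := re_select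
    (R := fun i p => p ≠ 0 ∧ ballCode (Nat.pair p (level p)) ∈ W i)
    (re_and (primrecPred_re (primrecPred_eq_const Primrec.snd 0).not) h1)
  refine ⟨g, hg, fun i y hy p => ?_⟩
  -- The ball of radius `2⁻ˡ`, `l = level p`, about `p ≠ 0` is `{p}`, so seeing its code in `W i`
  -- identifies the point.
  have key : ∀ p, (p ≠ 0 ∧ ballCode (Nat.pair p (level p)) ∈ W i) ↔ p ≠ 0 ∧ p = y := by
    intro p
    refine and_congr_right fun hp => ?_
    rw [ballCode_mem_W sequenceSpace_symm hy, restrict_Mem, Nat.unpair_pair]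
    exact (sequenceSpace_isolated hp).trans eq_comm
  constructor
  · exact fun hp => (key p).1 (hg1 i p hp)
  · intro hp
    have hd : (g i).Dom := (hg2 i).2 ⟨p, (key p).2 hp⟩
    have h := (key _).1 (hg1 i _ (Part.get_mem hd))
    rw [hp.2, ← h.2]
    exact Part.get_mem hd

/-- The predicate that holds at `0` and at the points that have a small index with respect to
their level. -/
def smallIndex (g : ℕ →. ℕ) (y : sequenceSpace.computablePoints) : Prop :=
  y.1 = 0 ∨ ∃ j < level y.1, y.1 ∈ g j

theorem smallIndex_isEffectiveOperator {g : ℕ →. ℕ} (hg : Partrec g)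
    (h : ∀ i, ∀ y ∈ sequenceSpace.xc.toFun i, ∀ p, p ∈ g i ↔ p ≠ 0 ∧ p = y) :
    IsEffectiveOperator sequenceSpace.xc haltNumbering (smallIndex g) := by
  -- The radius `2⁻ⁱ` is taken from the given index `i` itself, which makes `i` a small index for
  -- any nonzero point in this ball.
  have hc0 : Computable fun i : ℕ => (i, Nat.pair 0 i) :=
    Computable.id.pair (computable_natPair (Computable.const 0) Computable.id)
  have h0 := re_comp re_ballCode_mem_W hc0
  have hc1 : Computable fun t : (ℕ × ℕ) × ℕ => (t.2, t.1.2) :=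
    Computable.snd.pair (Computable.snd.comp Computable.fst)
  have h1 := re_comp (re_mem_graph hg) hc1
  have h2 : REPred fun t : (ℕ × ℕ) × ℕ => t.2 < level t.1.2 :=
    primrecPred_re (Primrec.nat_lt.comp Primrec.snd
      (primrec_level.comp (Primrec.snd.comp Primrec.fst)))
  have h3 := re_exists (R := fun (t : ℕ × ℕ) j => j < level t.2 ∧ t.2 ∈ g j) (re_and h2 h1)
  have h4 := re_exists (R := fun i p => p ∈ g i ∧ ∃ j, j < level p ∧ p ∈ g j)
    (re_and (re_mem_graph hg) h3)
  obtain ⟨f, hf, hf1⟩ := exists_halt_index (re_or h0 h4)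
  refine ⟨fun i => Part.some (f i), hf, fun i y hy => ⟨f i, Part.mem_some _, ?_⟩⟩
  refine mem_haltNumbering.2 (Iff.trans ?_ (mem_haltNumbering.1 (hf1 i)))
  have hball : ballCode (Nat.pair 0 i) ∈ W i ↔ y.1 = 0 ∨ i < level y.1 := by
    rw [ballCode_mem_W sequenceSpace_symm hy, restrict_Mem, Nat.unpair_pair]
    exact sequenceSpace_near_zero
  change _ ↔ ballCode (Nat.pair 0 i) ∈ W i ∨ ∃ p, p ∈ g i ∧ ∃ j, j < level p ∧ p ∈ g j
  rw [hball]
  constructor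
  · rintro (h0 | h1)
    · exact Or.inl (Or.inl h0)
    · by_cases h0 : y.1 = 0
      · exact Or.inl (Or.inl h0)
      · exact Or.inr ⟨y.1, (h i y hy _).2 ⟨h0, rfl⟩, h1⟩
  · rintro ((h0 | h1) | ⟨p, hp, hj⟩)
    · exact Or.inl h0
    · by_cases h0 : y.1 = 0
      · exact Or.inl h0
      · exact Or.inr ⟨i, h1, (h i y hy _).2 ⟨h0, rfl⟩⟩
    -- The witness `j` need not be an index of any point; only the value `g j` counts.
    · obtain ⟨-, rfl⟩ := (h i y hy p).1 hp
      exact Or.inr hj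

theorem smallIndex_not_isOpen (g : ℕ →. ℕ) :
    ¬ @IsOpen _ (sequenceSpace.space.restrict sequenceSpace.computablePoints).top
      {y | smallIndex g y} := by
  intro h
  let := sequenceSpace.topology
  obtain ⟨O, hO, e⟩ := isOpen_induced_iff.1 h
  have hmem : ∀ y (hy : y ∈ sequenceSpace.computablePoints), y ∈ O ↔ smallIndex g ⟨y, hy⟩ :=
    fun y hy => Set.ext_iff.1 e ⟨y, hy⟩
  obtain ⟨r, hr, hrO⟩ := hO 0 ((hmem 0 (mem_sequenceSpace_computablePoints 0)).2 (Or.inl rfl))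
  obtain ⟨n, hn⟩ := exists_pow_lt_of_lt_one hr (by norm_num : (1 / 2 : ℝ) < 1)
  have hlev : ∀ k, level (Nat.pair n k + 1) = n := fun k => by simp [level]
  -- The points `Nat.pair n k + 1` fill level `n`. If all were small, infinitely many `k` would
  -- share `n` witnesses, contradicting that `g` is single-valued.
  have hsmall : ∀ k, ∃ j : Fin n, Nat.pair n k + 1 ∈ g j := by
    intro k
    have hk : Nat.pair n k + 1 ∈ O := by
      refine hrO ?_
      change sequenceSpace.δ 0 (Nat.pair n k + 1) < r
      rwa [sequenceSpace_delta_zero, weight, if_neg (Nat.succ_ne_zero _), hlev]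
    rcases (hmem _ (mem_sequenceSpace_computablePoints _)).1 hk with h0 | ⟨j, hj, hgj⟩
    · exact absurd h0 (Nat.succ_ne_zero _)
    · exact ⟨⟨j, hlev k ▸ hj⟩, hgj⟩
  choose j hj using hsmall
  refine not_injective_infinite_finite j fun k k' hkk => ?_
  have h1 := Part.mem_unique (hj k) (hkk ▸ hj k')
  exact (Nat.pair_eq_pair.1 (Nat.succ_injective h1)).2

/-- A discontinuous effective operator from the computable points of a computable metric space
into Sierpinski space. -/
theorem exists_discontinuous_effectiveOperator :
    ∃ (X : Type) (q : SepQuasiMetric X) (x' : PNumbering Prop) (F : q.computablePoints → Prop),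
      (∀ y z, q.δ y z = q.δ z y) ∧ q.IsComputable ∧ Nonempty q.computablePoints ∧
      q.computableBiSpace.IsBiEffective q.xc ∧
      q.computableBiSpace.IsComputablyBiSeparable q.xc ∧
      q.computableBiSpace.IsBiAcceptable q.xc ∧
      sierpinski.biSpace.IsEffectivelyPairwiseRegular x' ∧
      sierpinski.biSpace.τ.IsAcceptable x' ∧
      ¬ sierpinski.biSpace.σ.IsComputable x' ∧
      IsEffectiveOperator q.xc x' F ∧
      ¬ @Continuous _ _ q.computableBiSpace.τ.top sierpinski.biSpace.τ.top F ∧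
      ¬ EffectivelyBiContinuous q.computableBiSpace sierpinski.biSpace F := by
  obtain ⟨g, hg, h⟩ := exists_point_of_index
  -- The basic set `{⊤}`, whose preimage under `smallIndex g` refutes both continuity and effective
  -- bi-continuity.
  have hV : {y : Prop | y} ∈ sierpinski.space.B (Nat.pair 1 0) :=
    sierpinski_mem_B.2 (by simp)
  refine ⟨ℕ, sequenceSpace, haltNumbering, smallIndex g, sequenceSpace_symm,
    sequenceSpace_isComputable, ⟨⟨0, mem_sequenceSpace_computablePoints 0⟩⟩,
    xc_isBiEffective sequenceSpace_symm sequenceSpace_isComputable,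
    xc_isComputablyBiSeparable sequenceSpace_isComputable Function.surjective_id,
    xc_isBiAcceptable sequenceSpace_symm sequenceSpace_isComputable,
    sierpinski_isEffectivelyPairwiseRegular _, sierpinski_isAcceptable_halt,
    sierpinski_conj_not_isComputable_halt, smallIndex_isEffectiveOperator hg h, ?_, ?_⟩
  · intro hF
    let := sierpinski.space.top
    exact smallIndex_not_isOpen g
      ((@continuous_def _ _ _ sierpinski.space.top _).1 hF _
        (sierpinski.space.isBasis.isOpen ⟨_, hV⟩))
  · exact fun hF => smallIndex_not_isOpen g (hF.1.isOpen_preimage hV)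

end EffTop

theorem mainTheorem9 :
    -- The continuity theorem fails if `x'` is only computable with respect to `τ'`.
    (¬ ∀ (T T' : Type) (_ : Nonempty T) (_ : Nonempty T') (𝒯 : BiSpace T) (𝒯' : BiSpace T')
        (x : PNumbering T) (x' : PNumbering T'),
        𝒯.IsBiEffective x → 𝒯.IsComputablyBiSeparable x → 𝒯.IsBiAcceptable x →
        𝒯'.τ.IsComputable x' → 𝒯'.IsEffectivelyPairwiseRegular x' →
        ∀ F : T → T', IsEffectiveOperator x x' F → EffectivelyBiContinuous 𝒯 𝒯' F) ∧
    -- Sierpinski space is a computable quasi-metric space, all points of which are computable.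
    (sierpinski.topology = sierpinskiSpace ∧ sierpinski.IsComputable ∧
      sierpinski.computablePoints = Set.univ) ∧
    -- The failure is witnessed by a discontinuous effective operator from the computable points of
    -- a computable metric space into Sierpinski space.
    ∃ (X : Type) (q : SepQuasiMetric X) (x' : PNumbering Prop) (F : q.computablePoints → Prop),
      (∀ y z, q.δ y z = q.δ z y) ∧ q.IsComputable ∧
      q.computableBiSpace.IsBiEffective q.xc ∧
      q.computableBiSpace.IsComputablyBiSeparable q.xc ∧
      q.computableBiSpace.IsBiAcceptable q.xc ∧
      sierpinski.biSpace.IsEffectivelyPairwiseRegular x' ∧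
      sierpinski.biSpace.τ.IsAcceptable x' ∧
      ¬ sierpinski.biSpace.σ.IsComputable x' ∧
      IsEffectiveOperator q.xc x' F ∧
      ¬ @Continuous _ _ q.computableBiSpace.τ.top sierpinski.biSpace.τ.top F ∧
      ¬ EffectivelyBiContinuous q.computableBiSpace sierpinski.biSpace F := by
  obtain ⟨X, q, x', F, hs, hc, hne, heff, hsep, hacc, hreg, hacc', hn, hF, hcont, hbi⟩ :=
    exists_discontinuous_effectiveOperator
  refine ⟨fun h => hbi ?_, ⟨sierpinski_topology, sierpinski_isComputable,
    sierpinski_computablePoints⟩, X, q, x', F, hs, hc, heff, hsep, hacc, hreg, hacc', hn, hF,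
    hcont, hbi⟩
  exact h _ _ hne ⟨True⟩ _ _ _ _ heff hsep hacc hacc'.2 hreg F hF
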